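/- Let $\theta\in\mathbb{R}$ and let $A=(a_{ij})$ be a real symmetric $n\times n$ matrix. Let $G_A$ be the simple graph on $\{1,\dots,n\}$ in which distinct $i,j$ are adjacent if and only if $a_{ij}\neq 0$, and assume that $A$ is acyclic, i.e. that $G_A$ is a forest. Let $m_\theta(A)$ be the multiplicity of $\theta$ as an eigenvalue of $A$ (the dimension of the $\theta$-eigenspace; $0$ if $\theta$ is not an eigenvalue). Put - $\mathcal{N}_\theta(A)=\{u : x_u=0 \text{ for every } \theta\text{-eigenvector } x \text{ of } A\}$ (so all vertices belong to it if $\theta$ is not an eigenvalue); - $\mathcal{N}^\circ_\theta(A)=\{u\in\mathcal{N}_\theta(A) : \text{all neighbours of } u \text{ in } G_A \text{ lie in } \mathcal{N}_\theta(A)\}$ and $\partial\mathcal{N}_\theta(A)=\mathcal{N}_\theta(A)\setminus\mathcal{N}^\circ_\theta(A)$; - $\mathcal{E}^\circ_\theta(A)=\{uv\in E(G_A) : u,v\in\mathcal{N}_\theta(A)\}$; - $F=(V(G_A)\setminus\mathcal{N}^\circ_\theta(A),\ E(G_A)\setminus\mathcal{E}^\circ_\theta(A))$. The class $\mathcal{A}_\theta$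 is defined as follows. Let $\mathfrak{Z}_\theta$ be the set of real symmetric matrices $B$ such that $G_B$ is a tree and $m_\theta(B)=0$; let $\mathfrak{Min}_\theta$ be the set of real symmetric matrices $B$ such that $G_B$ is a tree and $B$ has a $\theta$-eigenvector with no zero entry; and let $\mathfrak{Link}_\theta$ be the set of all real $1\times1$ matrices, which serve as linking vertices. Connecting two matrices $B$ and $C$ means replacing $B\oplus C$ by $\begin{pmatrix}B&\omega E_{rs}\\ \omega E_{sr}&C\end{pmatrix}$ for some indices $r$ of $B$ and $s$ of $C$ and some real $\omega\ne0$, where $E_{rs}$ is the matrix unit. Choose finitely many pieces, each from $\mathfrak{Z}_\theta\cup\mathfrak{Min}_\theta$ or chosen as a linking vertex from $\mathfrak{Link}_\theta$, and connect some pairs of them so that (1) the graph of the resulting matrix is a tree; (2) no two pieces chosen from $\mathfrak{Z}_\theta\cup\mathfrak{Min}_\theta$ are connected; (3) every linking vertex is connected to at least two pieces chosen from $\mathfrak{Min}_\theta$ (pieces that are linking vertices are not counted). Then $\mathcal{A}_\theta$ is the set of all matrices $P(A_1\oplus\cdots\oplus A_k)P^T$ where $P$ is a permutation matrix and each $A_i$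 is obtained by this construction. Then: (i) $A\in\mathcal{A}_\theta$. (ii) $m_\theta(A)=c+\sum_{u\in\partial\mathcal{N}_\theta(A)}(d_F(u)-2)$, where $c$ is the number of connected components of $F$ and $d_F(u)$ is the degree of $u$ in $F$. (iii) $m_\theta(A)$ equals the number of connected components of $F-\partial\mathcal{N}_\theta(A)$ minus $|\partial\mathcal{N}_\theta(A)|$. -/

import Mathlib

namespace AcyclicMatrix

variable {V W : Type*}

/-- The graph `G_A` of a symmetric matrix `A`: distinct `i`, `j` are adjacent iff `A i j ≠ 0`.
(`fromRel` symmetrizes the relation, which changes nothing for a symmetric matrix.) -/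
def graph (A : Matrix V V ℝ) : SimpleGraph V :=
  SimpleGraph.fromRel fun i j => A i j ≠ 0

/-- `x` is a `θ`-eigenvector of `A`. -/
def IsEigenvector [Fintype V] (θ : ℝ) (A : Matrix V V ℝ) (x : V → ℝ) : Prop :=
  x ≠ 0 ∧ A.mulVec x = θ • x

/-- The multiplicity `m_θ(A)`: the dimension of the `θ`-eigenspace
(equal to `0` when `θ` is not an eigenvalue). -/
noncomputable def mult [Fintype V] [DecidableEq V] (θ : ℝ) (A : Matrix V V ℝ) : ℕ :=
  Module.finrank ℝ (Module.End.eigenspace (Matrix.toLin' A) θ)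

/-- The nodal vertices: those at which every `θ`-eigenvector vanishes. -/
def nodal [Fintype V] (θ : ℝ) (A : Matrix V V ℝ) : Set V :=
  {u | ∀ x : V → ℝ, IsEigenvector θ A x → x u = 0}

/-- The interior nodal vertices: nodal vertices all of whose neighbours are nodal. -/
def interiorNodal [Fintype V] (θ : ℝ) (A : Matrix V V ℝ) : Set V :=
  {u | u ∈ nodal θ A ∧ (graph A).neighborSet u ⊆ nodal θ A}

/-- The boundary nodal vertices. -/
def boundaryNodal [Fintype V] (θ : ℝ) (A : Matrix V V ℝ) : Set V :=
  nodal θ A \ interiorNodal θ A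

/-- The subgraph `F` of `G_A`: delete the interior nodal vertices and all the edges
that have both ends nodal. -/
def reduced [Fintype V] (θ : ℝ) (A : Matrix V V ℝ) : (graph A).Subgraph where
  verts := (interiorNodal θ A)ᶜ
  Adj u v := (graph A).Adj u v ∧ ¬ (u ∈ nodal θ A ∧ v ∈ nodal θ A)
  adj_sub h := h.1
  edge_vert h := fun hu => h.2 ⟨hu.1, hu.2 h.1⟩
  symm := ⟨fun _ _ h => ⟨h.1.symm, fun h' => h.2 ⟨h'.2, h'.1⟩⟩⟩

/-- The number of connected components of a subgraph. -/
noncomputable def numComponents {G : SimpleGraph V} (H : G.Subgraph) : ℕ :=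
  Nat.card H.coe.ConnectedComponent

/-- The degree of a vertex in a subgraph (of a finite graph). -/
noncomputable def deg {G : SimpleGraph V} (H : G.Subgraph) (u : V) : ℕ :=
  (H.neighborSet u).ncard

/-- The class `𝔷_θ`: symmetric matrices of trees that do not have the eigenvalue `θ`. -/
def IsZ [Fintype V] [DecidableEq V] (θ : ℝ) (A : Matrix V V ℝ) : Prop :=
  A.IsSymm ∧ (graph A).IsTree ∧ mult θ A = 0

/-- The class `𝔐𝔦𝔫_θ`: symmetric matrices of trees with a nowhere-zero `θ`-eigenvector. -/
def IsMin [Fintype V] (θ : ℝ) (A : Matrix V V ℝ) : Prop :=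
  A.IsSymm ∧ (graph A).IsTree ∧ ∃ x : V → ℝ, IsEigenvector θ A x ∧ ∀ i, x i ≠ 0

/-- The connection between `A` and `B` at the indices `r` and `s` with the weight `ω`. -/
def connection [DecidableEq V] [DecidableEq W] (A : Matrix V V ℝ) (B : Matrix W W ℝ)
    (r : V) (s : W) (ω : ℝ) : Matrix (V ⊕ W) (V ⊕ W) ℝ :=
  Matrix.fromBlocks A (Matrix.single r s ω) (Matrix.single s r ω) B

section Construction

variable {p : ℕ} {n : Fin p → ℕ}

/-- The submatrix of `M` on the blocks `j` and `k`. -/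
def twoBlocks (M : Matrix (Σ j, Fin (n j)) (Σ j, Fin (n j)) ℝ) (j k : Fin p) :
    Matrix (Fin (n j) ⊕ Fin (n k)) (Fin (n j) ⊕ Fin (n k)) ℝ :=
  M.submatrix (Sum.elim (fun a => ⟨j, a⟩) fun b => ⟨k, b⟩)
    (Sum.elim (fun a => ⟨j, a⟩) fun b => ⟨k, b⟩)

/-- In the block matrix `M`, the pieces `B j` and `B k` are connected (by a nonzero weight). -/
def Joined (B : ∀ j, Matrix (Fin (n j)) (Fin (n j)) ℝ)
    (M : Matrix (Σ j, Fin (n j)) (Σ j, Fin (n j)) ℝ) (j k : Fin p) : Prop :=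
  ∃ (r : Fin (n j)) (s : Fin (n k)) (ω : ℝ), ω ≠ 0 ∧
    twoBlocks M j k = connection (B j) (B k) r s ω

/-- `M` is an irreducible acyclic matrix that is made by connecting some of the pieces
`B 0, …, B (p - 1)`; here `L` is the set of (the positions of) the linking vertices. -/
structure IsConstruction (θ : ℝ) (L : Set (Fin p))
    (B : ∀ j, Matrix (Fin (n j)) (Fin (n j)) ℝ)
    (M : Matrix (Σ j, Fin (n j)) (Σ j, Fin (n j)) ℝ) : Prop where
  /-- the linking vertices are `1 × 1` matrices -/
  link : ∀ j ∈ L, n j = 1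
  /-- all other pieces belong to `𝔷_θ ∪ 𝔐𝔦𝔫_θ` -/
  piece : ∀ j ∉ L, IsZ θ (B j) ∨ IsMin θ (B j)
  /-- the diagonal blocks of `M` are the pieces -/
  diag : ∀ j, M.submatrix (Sigma.mk j) (Sigma.mk j) = B j
  /-- two different pieces are either connected or not connected -/
  offDiag : ∀ j k, j ≠ k → Joined B M j k ∨ twoBlocks M j k = Matrix.fromBlocks (B j) 0 0 (B k)
  /-- the result is acyclic and irreducible -/
  tree : (graph M).IsTree
  /-- two pieces from `𝔷_θ ∪ 𝔐𝔦𝔫_θ` are never connected -/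
  not_joined : ∀ j ∉ L, ∀ k ∉ L, j ≠ k → ¬ Joined B M j k
  /-- every linking vertex is connected to at least two pieces from `𝔐𝔦𝔫_θ` -/
  two_min : ∀ j ∈ L, ∃ k ∉ L, ∃ l ∉ L, k ≠ l ∧
    IsMin θ (B k) ∧ IsMin θ (B l) ∧ Joined B M j k ∧ Joined B M j l

end Construction

/-- The class `𝒜_θ`: up to a simultaneous permutation of rows and columns, `A` is a direct sum
of `k` matrices, each obtained by the construction above. -/
def ClassA (θ : ℝ) (A : Matrix V V ℝ) : Prop :=
  ∃ (k : ℕ) (p : Fin k → ℕ) (n : ∀ i, Fin (p i) → ℕ)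
    (M : ∀ i, Matrix (Σ j, Fin (n i j)) (Σ j, Fin (n i j)) ℝ)
    (e : (Σ i, Σ j, Fin (n i j)) ≃ V),
    (∀ i, ∃ (L : Set (Fin (p i))) (B : ∀ j, Matrix (Fin (n i j)) (Fin (n i j)) ℝ),
      IsConstruction θ L B (M i)) ∧
    A = Matrix.reindex e e (Matrix.blockDiagonal' M)

end AcyclicMatrix

/-! ### Flows on forests -/

namespace SimpleGraph

variable {V : Type*} {G : SimpleGraph V}

/-! Write `N` for the nodal set and `∂N` for its boundary, and take a generic `x` in the eigenspace,
vanishing exactly on `N`. If `z` satisfies the eigenvector equation off `N`, the Wronskian `A v w *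
(z v * x w - x v * z w)` is a flow without sources or sinks, so it vanishes on a forest
(`flow_eq_zero`, `mul_comm_of_adj`). Hence `z` vanishes on `∂N`, and on each component of `G_A - N`
it is a multiple of `x`.

By duality, the first consequence shows that every vector supported on `∂N` is `(A - θ) z` for some
`z` vanishing on `N` (`exists_mulVec_sub_smul_eq`). The second gives one free scalar per component
of `G_A - N`. The equations at `∂N` are thus independent constraints on these scalars and cut out
the eigenspace, which gives (iii). Euler's formula for forests turns (iii) into (ii).

For (i), the boundary vertices are the linking vertices, and the other pieces are the components of
`G_A - ∂N`. Non-nodal pieces inherit `x`; interior nodal pieces do not have the eigenvalue `θ`, by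
the same surjectivity. -/

/-- On a finite forest, a flow without sources and sinks vanishes. -/
theorem IsAcyclic.flow_eq_zero [Fintype V] (hG : G.IsAcyclic) {f : V → V → ℝ}
    (hanti : ∀ v w, f v w = - f w v) (hsupp : ∀ v w, ¬ G.Adj v w → f v w = 0)
    (hdiv : ∀ v, ∑ w, f v w = 0) (v w : V) : f v w = 0 := by
  classical
  by_cases hvw : G.Adj v w
  swap
  · exact hsupp v w hvw
  have hb := isBridge_iff.1 (isAcyclic_iff_forall_adj_isBridge.1 hG hvw)
  set G' := G.deleteEdges {s(v, w)}
  -- `C` is the side of `v` once the bridge `vw` is cut: the total divergence over `C` is exactly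
  -- the flow through `vw`.
  let C : Finset V := Finset.univ.filter (G'.Reachable v)
  have hin : ∑ a ∈ C, ∑ b ∈ C, f a b = 0 := by
    have h : ∑ a ∈ C, ∑ b ∈ C, f a b = - ∑ a ∈ C, ∑ b ∈ C, f a b := by
      conv_lhs => rw [Finset.sum_comm]
      simp only [← Finset.sum_neg_distrib]
      exact Finset.sum_congr rfl fun a _ => Finset.sum_congr rfl fun b _ => hanti b a
    linarith
  have hout : ∑ a ∈ C, ∑ b ∈ Cᶜ, f a b = f v w := by
    have hz : ∀ a ∈ C, ∀ b ∈ Cᶜ, (a ≠ v ∨ b ≠ w) → f a b = 0 := by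
      intro a ha b hb hab
      simp only [C, Finset.mem_compl, Finset.mem_filter, Finset.mem_univ, true_and] at ha hb
      refine hsupp a b fun h => hb (ha.trans (Adj.reachable ?_))
      refine deleteEdges_adj.2 ⟨h, fun he => ?_⟩
      rcases Sym2.eq_iff.1 (Set.mem_singleton_iff.1 he) with ⟨rfl, rfl⟩ | ⟨rfl, rfl⟩
      · simp at hab
      · exact hb (Reachable.refl _)
    have hvC : v ∈ C := by simp [C]
    have hwC : w ∈ Cᶜ := by simpa [C] using hb
    rw [Finset.sum_eq_single_of_mem v hvC
      fun a ha hav => Finset.sum_eq_zero fun b hb => hz a ha b hb (Or.inl hav),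
      Finset.sum_eq_single_of_mem w hwC fun b hb hbw => hz v hvC b hb (Or.inr hbw)]
  have htot : ∑ a ∈ C, (∑ b ∈ C, f a b + ∑ b ∈ Cᶜ, f a b) = 0 :=
    Finset.sum_eq_zero fun a _ => by rw [Finset.sum_add_sum_compl, hdiv]
  rw [Finset.sum_add_distrib, hin, hout, zero_add] at htot
  exact htot

end SimpleGraph

/-! ### The eigenspace and the nodal vertices -/

namespace AcyclicMatrix

open Matrix

variable {V : Type*} {θ : ℝ} {A : Matrix V V ℝ}

theorem graph_adj (hA : A.IsSymm) {v w : V} : (graph A).Adj v w ↔ v ≠ w ∧ A v w ≠ 0 := by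
  rw [graph, SimpleGraph.fromRel_adj, hA.apply v w, or_self]

theorem eq_zero_of_not_adj (hA : A.IsSymm) {v w : V} (hvw : v ≠ w) (h : ¬ (graph A).Adj v w) :
    A v w = 0 := by
  by_contra h0
  exact h ((graph_adj hA).2 ⟨hvw, h0⟩)

variable [Fintype V]

theorem mulVec_apply_eq_sum (A : Matrix V V ℝ) (z : V → ℝ) (v : V) :
    (A *ᵥ z) v = ∑ w, A v w * z w := rfl

theorem mem_nodal_iff {u : V} : u ∈ nodal θ A ↔ ∀ x : V → ℝ, A *ᵥ x = θ • x → x u = 0 := by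
  refine ⟨fun h x hx => ?_, fun h x hx => h x hx.2⟩
  by_cases h0 : x = 0
  · simp [h0]
  · exact h x ⟨h0, hx⟩

theorem mem_boundaryNodal_iff {u : V} :
    u ∈ boundaryNodal θ A ↔ u ∈ nodal θ A ∧ ∃ w ∉ nodal θ A, (graph A).Adj u w := by
  simp only [boundaryNodal, interiorNodal, Set.mem_sdiff, Set.mem_ofPred_eq, Set.not_subset, not_and,
    SimpleGraph.mem_neighborSet]
  constructor
  · rintro ⟨h, h'⟩
    obtain ⟨w, hw, hw'⟩ := h' h
    exact ⟨h, w, hw', hw⟩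
  · rintro ⟨h, w, hw, hw'⟩
    exact ⟨h, fun _ => ⟨w, hw', hw⟩⟩

/-- Some vector of the `θ`-eigenspace vanishes on the nodal vertices only. -/
theorem exists_generic (θ : ℝ) (A : Matrix V V ℝ) :
    ∃ x : V → ℝ, A *ᵥ x = θ • x ∧ ∀ u, x u = 0 ↔ u ∈ nodal θ A := by
  classical
  -- Each non-nodal coordinate is a nonzero functional on the eigenspace, and finitely many proper
  -- subspaces do not cover a real vector space.
  obtain ⟨x, hx, hx'⟩ := Module.Dual.exists_forall_mem_ne_zero_of_forall_exists
    (Module.End.eigenspace (Matrix.toLin' A) θ)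
    (fun u : {u // u ∉ nodal θ A} => (LinearMap.proj u.1 : (V → ℝ) →ₗ[ℝ] ℝ))
    (by
      rintro ⟨u, hu⟩
      rw [mem_nodal_iff] at hu
      push Not at hu
      obtain ⟨x, hx, hxu⟩ := hu
      exact ⟨x, by simpa [Module.End.mem_eigenspace_iff] using hx, hxu⟩)
  have hx1 : A *ᵥ x = θ • x := by simpa [Module.End.mem_eigenspace_iff] using hx
  exact ⟨x, hx1, fun u => ⟨fun h => by_contra fun hu => hx' ⟨u, hu⟩ h,
    fun hu => mem_nodal_iff.1 hu x hx1⟩⟩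

/-- If `x` is a `θ`-eigenvector and `z` satisfies the eigenvector equation on the support of `x`,
then `x` and `z` are proportional along the edges. -/
theorem mul_comm_of_adj (hA : A.IsSymm) (hG : (graph A).IsAcyclic) {x z : V → ℝ}
    (hx : A *ᵥ x = θ • x) (hz : ∀ v, x v ≠ 0 → (A *ᵥ z) v = θ * z v) {v w : V}
    (hvw : (graph A).Adj v w) : z v * x w = x v * z w := by
  have key := hG.flow_eq_zero (f := fun v w => A v w * (z v * x w - x v * z w))
    (fun v w => by rw [hA.apply w v]; ring)
    (fun v w h => by
      by_cases hvw : v = w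
      · subst hvw; ring
      · rw [eq_zero_of_not_adj hA hvw h, zero_mul])
    -- The divergence at `v` is `z v * (A *ᵥ x) v - x v * (A *ᵥ z) v`. Where `x v = 0`, both terms
    -- vanish, so nothing is needed of `z` there.
    (fun v => by
      have h1 : ∑ w, A v w * (z v * x w - x v * z w) = z v * (A *ᵥ x) v - x v * (A *ᵥ z) v := by
        simp only [mulVec, dotProduct, Finset.mul_sum, ← Finset.sum_sub_distrib]
        exact Finset.sum_congr rfl fun w _ => by ring
      rw [h1, hx]
      by_cases h0 : x v = 0
      · simp [h0]
      · rw [hz v h0, Pi.smul_apply, smul_eq_mul]; ring) v w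
  exact sub_eq_zero.1 ((mul_eq_zero.1 key).resolve_left ((graph_adj hA).1 hvw).2)

/-- Proportionality along an edge from `u` to a non-nodal `w` reads `z u * x w = 0` with `x w ≠ 0`.
-/
theorem eq_zero_of_mem_boundaryNodal (hA : A.IsSymm) (hG : (graph A).IsAcyclic) {z : V → ℝ}
    (hz : ∀ v ∉ nodal θ A, (A *ᵥ z) v = θ * z v) {u : V} (hu : u ∈ boundaryNodal θ A) :
    z u = 0 := by
  obtain ⟨x, hx, hx0⟩ := exists_generic θ A
  obtain ⟨huN, w, hw, huw⟩ := mem_boundaryNodal_iff.1 hu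
  have h := mul_comm_of_adj hA hG hx (fun v hv => hz v fun h => hv ((hx0 v).2 h)) huw
  rw [(hx0 u).2 huN, zero_mul] at h
  exact (mul_eq_zero.1 h).resolve_right fun h => hw ((hx0 w).1 h)

/-- Every vector on the boundary nodal vertices is the image under `A - θ` of a vector that
vanishes on the nodal vertices. -/
theorem exists_mulVec_sub_smul_eq (hA : A.IsSymm) (hG : (graph A).IsAcyclic) {g : V → ℝ}
    (hg : ∀ u ∉ boundaryNodal θ A, g u = 0) :
    ∃ z : V → ℝ, (∀ u ∈ nodal θ A, z u = 0) ∧ A *ᵥ z - θ • z = g := by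
  classical
  -- `D` projects onto vectors vanishing on the nodal set, so the claim is that `g` lies in the
  -- range of `(A - θ) D`.
  let D : Matrix V V ℝ := diagonal fun v => if v ∈ nodal θ A then 0 else 1
  let T : (V → ℝ) →ₗ[ℝ] (V → ℝ) := (A - θ • (1 : Matrix V V ℝ)).mulVecLin ∘ₗ D.mulVecLin
  by_cases hgT : g ∈ LinearMap.range T
  · obtain ⟨y, hy⟩ := hgT
    refine ⟨D *ᵥ y, fun u hu => by simp [D, mulVec_diagonal, hu], ?_⟩
    rw [← hy]
    simp [T]
  exfalso
  obtain ⟨f, hfg, hf⟩ := Submodule.exists_dual_map_eq_bot_of_notMem hgT inferInstance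
  obtain ⟨y, rfl⟩ := (dotProductEquiv ℝ V).surjective f
  -- A functional `y` that kills the range satisfies the eigenvector equation off the nodal set, by
  -- symmetry of `A`. It then vanishes on the boundary, hence kills `g`.
  have hy : ∀ v ∉ nodal θ A, (A *ᵥ y) v = θ * y v := by
    intro v hv
    have h1 : (dotProductEquiv ℝ V y) (T (Pi.single v 1)) = 0 := by
      rw [← Submodule.mem_bot ℝ, ← hf]
      exact Submodule.mem_map_of_mem (LinearMap.mem_range_self T _)
    have h2 : D *ᵥ Pi.single v 1 = Pi.single v 1 := by
      ext w
      by_cases hwv : w = v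
      · subst hwv; simp [D, mulVec_diagonal, hv]
      · simp [D, mulVec_diagonal, hwv]
    have h3 : (A - θ • (1 : Matrix V V ℝ))ᵀ = A - θ • (1 : Matrix V V ℝ) := by
      rw [transpose_sub, hA.eq, transpose_smul, transpose_one]
    simp only [T, LinearMap.comp_apply, mulVecLin_apply, h2, dotProductEquiv_apply_apply] at h1
    rw [dotProduct_mulVec, dotProduct_single_one, ← mulVec_transpose, h3, sub_mulVec,
      smul_mulVec, one_mulVec] at h1
    simpa [sub_eq_zero] using h1
  apply hfg
  rw [dotProductEquiv_apply_apply]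
  refine Finset.sum_eq_zero fun u _ => ?_
  by_cases hu : u ∈ boundaryNodal θ A
  · rw [eq_zero_of_mem_boundaryNodal hA hG hy hu, zero_mul]
  · rw [hg u hu, mul_zero]

/-- The vector that is `c i • x` on the component `i` of the graph on the non-nodal vertices,
and zero on the nodal vertices. -/
noncomputable def scaleComponents (θ : ℝ) (A : Matrix V V ℝ) (x : V → ℝ) :
    (((graph A).induce (nodal θ A)ᶜ).ConnectedComponent → ℝ) →ₗ[ℝ] (V → ℝ) :=
  open Classical in
  { toFun c v := if h : v ∈ (nodal θ A)ᶜ then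
      c (((graph A).induce (nodal θ A)ᶜ).connectedComponentMk ⟨v, h⟩) * x v else 0
    map_add' c d := by
      ext v
      by_cases h : v ∈ (nodal θ A)ᶜ <;> simp only [Pi.add_apply, h, dif_pos, dif_neg,
        not_false_eq_true] <;> ring
    map_smul' a c := by
      ext v
      by_cases h : v ∈ (nodal θ A)ᶜ <;> simp only [Pi.smul_apply, smul_eq_mul, RingHom.id_apply,
        h, dif_pos, dif_neg, not_false_eq_true] <;> ring }

theorem scaleComponents_apply {x : V → ℝ}
    (c : ((graph A).induce (nodal θ A)ᶜ).ConnectedComponent → ℝ) {v : V} (h : v ∉ nodal θ A) :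
    scaleComponents θ A x c v =
      c (((graph A).induce (nodal θ A)ᶜ).connectedComponentMk ⟨v, h⟩) * x v :=
  dif_pos (show v ∈ (nodal θ A)ᶜ from h)

theorem scaleComponents_apply_of_mem {x : V → ℝ}
    (c : ((graph A).induce (nodal θ A)ᶜ).ConnectedComponent → ℝ) {v : V} (h : v ∈ nodal θ A) :
    scaleComponents θ A x c v = 0 :=
  dif_neg (show v ∉ (nodal θ A)ᶜ from fun h' => h' h)

theorem scaleComponents_injective {x : V → ℝ} (hx : ∀ u, x u = 0 ↔ u ∈ nodal θ A) :
    Function.Injective (scaleComponents θ A x) := by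
  intro c d h
  ext i
  induction i using SimpleGraph.ConnectedComponent.ind with | _ v
  have := congrFun h v.1
  rw [scaleComponents_apply c v.2, scaleComponents_apply d v.2] at this
  exact mul_right_cancel₀ (fun h0 => v.2 ((hx v.1).1 h0)) this

/-- The ratio `z / x` is constant along edges between non-nodal vertices, hence on components. -/
theorem exists_scaleComponents_eq (hA : A.IsSymm) (hG : (graph A).IsAcyclic) {x z : V → ℝ}
    (hx : A *ᵥ x = θ • x) (hx0 : ∀ u, x u = 0 ↔ u ∈ nodal θ A)
    (hz0 : ∀ u ∈ nodal θ A, z u = 0) (hz : ∀ v ∉ nodal θ A, (A *ᵥ z) v = θ * z v) :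
    ∃ c, scaleComponents θ A x c = z := by
  have hne : ∀ v : ((nodal θ A)ᶜ : Set V), x v.1 ≠ 0 := fun v h0 => v.2 ((hx0 v.1).1 h0)
  have hadj : ∀ v w : ((nodal θ A)ᶜ : Set V), (graph A).Adj v.1 w.1 →
      z v.1 / x v.1 = z w.1 / x w.1 := by
    intro v w hvw
    have h := mul_comm_of_adj hA hG hx (fun v hv => hz v fun h => hv ((hx0 v).2 h)) hvw
    rw [div_eq_div_iff (hne v) (hne w), h, mul_comm]
  let c : ((graph A).induce (nodal θ A)ᶜ).ConnectedComponent → ℝ :=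
    SimpleGraph.ConnectedComponent.lift (fun v => z v.1 / x v.1) fun v w p _ => by
      induction p with
      | nil => rfl
      | cons h p ih => exact (hadj _ _ h).trans (ih (by simp_all))
  refine ⟨c, funext fun v => ?_⟩
  by_cases hv : v ∈ nodal θ A
  · rw [scaleComponents_apply_of_mem c hv, hz0 v hv]
  · rw [scaleComponents_apply c hv]
    exact div_mul_cancel₀ _ (hne ⟨v, hv⟩)

/-- At a non-nodal vertex all contributing neighbours carry the same scalar; an interior nodal
vertex has only nodal neighbours. Only boundary vertices can see several components. -/
theorem mulVec_scaleComponents (hA : A.IsSymm) {x : V → ℝ}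
    (hx : A *ᵥ x = θ • x) (hx0 : ∀ u, x u = 0 ↔ u ∈ nodal θ A)
    (c : ((graph A).induce (nodal θ A)ᶜ).ConnectedComponent → ℝ) {v : V}
    (hv : v ∉ boundaryNodal θ A) :
    (A *ᵥ scaleComponents θ A x c) v = θ * scaleComponents θ A x c v := by
  by_cases hvN : v ∈ nodal θ A
  · rw [scaleComponents_apply_of_mem c hvN, mul_zero, mulVec_apply_eq_sum]
    refine Finset.sum_eq_zero fun w _ => ?_
    by_cases hw : w ∈ nodal θ A
    · rw [scaleComponents_apply_of_mem c hw, mul_zero]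
    · rw [eq_zero_of_not_adj hA (ne_of_mem_of_not_mem hvN hw)
        (fun h => hv (mem_boundaryNodal_iff.2 ⟨hvN, w, hw, h⟩)), zero_mul]
  · set a := c (((graph A).induce (nodal θ A)ᶜ).connectedComponentMk ⟨v, hvN⟩) with ha
    have h1 : (A *ᵥ scaleComponents θ A x c) v = ∑ w, a * (A v w * x w) := by
      rw [mulVec_apply_eq_sum]
      refine Finset.sum_congr rfl fun w _ => ?_
      by_cases hw : w ∈ nodal θ A
      · rw [scaleComponents_apply_of_mem c hw, (hx0 w).2 hw]; ring
      rw [scaleComponents_apply c hw]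
      by_cases hvw : v = w
      · subst hvw; rw [← ha]; ring
      by_cases hadj : (graph A).Adj v w
      · have : ((graph A).induce (nodal θ A)ᶜ).connectedComponentMk ⟨w, hw⟩ =
            ((graph A).induce (nodal θ A)ᶜ).connectedComponentMk ⟨v, hvN⟩ :=
          SimpleGraph.ConnectedComponent.sound (SimpleGraph.Adj.reachable (by simpa using hadj.symm))
        rw [this, ← ha]; ring
      · rw [eq_zero_of_not_adj hA hvw hadj, zero_mul, zero_mul, mul_zero]
    have h2 : ∑ w, A v w * x w = θ * x v := congrFun hx v
    rw [h1, ← Finset.mul_sum, h2, scaleComponents_apply c hvN, ← ha]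
    ring

/-- Rank-nullity for the map `Φ` from component scalars to the errors of the eigenvector equation at
the boundary: `Φ` is surjective, and its kernel is isomorphic to the eigenspace. -/
theorem mult_add_ncard_boundaryNodal [DecidableEq V] (hA : A.IsSymm)
    (hG : (graph A).IsAcyclic) :
    mult θ A + (boundaryNodal θ A).ncard =
      Nat.card ((graph A).induce (nodal θ A)ᶜ).ConnectedComponent := by
  classical
  obtain ⟨x, hx, hx0⟩ := exists_generic θ A
  set Ψ := scaleComponents θ A x
  let T : (V → ℝ) →ₗ[ℝ] (V → ℝ) := Matrix.toLin' A - θ • LinearMap.id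
  have hT : ∀ z, T z = A *ᵥ z - θ • z := fun z => by simp [T]
  let Φ : (((graph A).induce (nodal θ A)ᶜ).ConnectedComponent → ℝ) →ₗ[ℝ]
      (boundaryNodal θ A → ℝ) := LinearMap.funLeft ℝ ℝ Subtype.val ∘ₗ T ∘ₗ Ψ
  have hΦ : ∀ c u, Φ c u = (A *ᵥ Ψ c - θ • Ψ c) u.1 := fun c u => by
    rw [← hT]; rfl
  have hsurj : LinearMap.range Φ = ⊤ := by
    refine LinearMap.range_eq_top.2 fun g => ?_
    obtain ⟨z, hz0, hz⟩ := exists_mulVec_sub_smul_eq hA hG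
      (g := fun v => if h : v ∈ boundaryNodal θ A then g ⟨v, h⟩ else 0)
      (fun u hu => dif_neg hu)
    obtain ⟨c, hc⟩ := exists_scaleComponents_eq hA hG hx hx0 hz0 fun v hv => by
      have := congrFun hz v
      rw [dif_neg (fun h => hv h.1)] at this
      simpa [sub_eq_zero] using this
    refine ⟨c, funext fun u => ?_⟩
    rw [hΦ, hc, hz]
    exact dif_pos u.2
  have hker : (LinearMap.ker Φ).map Ψ = Module.End.eigenspace (Matrix.toLin' A) θ := by
    ext z
    rw [Module.End.mem_eigenspace_iff, Matrix.toLin'_apply, Submodule.mem_map]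
    constructor
    · rintro ⟨c, hc, rfl⟩
      ext v
      by_cases hv : v ∈ boundaryNodal θ A
      · have := hΦ c ⟨v, hv⟩
        rw [LinearMap.mem_ker.1 hc, Pi.zero_apply, Pi.sub_apply] at this
        exact (sub_eq_zero.1 this.symm)
      · exact mulVec_scaleComponents hA hx hx0 c hv
    · intro hz
      obtain ⟨c, hc⟩ := exists_scaleComponents_eq hA hG hx hx0
        (fun u hu => mem_nodal_iff.1 hu z hz) (fun v _ => congrFun hz v)
      refine ⟨c, LinearMap.mem_ker.2 (funext fun u => ?_), hc⟩
      rw [hΦ, hc, hz, sub_self]; rfl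
  have h1 := LinearMap.finrank_range_add_finrank_ker Φ
  rw [hsurj, finrank_top, Module.finrank_fintype_fun_eq_card,
    Module.finrank_fintype_fun_eq_card] at h1
  have h2 := (Submodule.equivMapOfInjective Ψ (scaleComponents_injective hx0)
    (LinearMap.ker Φ)).finrank_eq
  rw [hker] at h2
  rw [mult, ← h2, Nat.card_eq_fintype_card, ← h1, add_comm, ← Nat.card_coe_set_eq,
    Nat.card_eq_fintype_card]

end AcyclicMatrix

/-! ### Euler's formula and deletion of independent vertices -/

namespace SimpleGraph

variable {V : Type*} {G : SimpleGraph V}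

theorem ConnectedComponent.ncard_neighborSet_toSimpleGraph (C : G.ConnectedComponent)
    (v : C) : (C.toSimpleGraph.neighborSet v).ncard = (G.neighborSet v).ncard := by
  rw [← Set.ncard_image_of_injective _ Subtype.val_injective]
  congr 1
  ext w
  constructor
  · rintro ⟨w, hw, rfl⟩
    exact hw
  · intro hw
    exact ⟨⟨w, C.mem_supp_of_adj_mem_supp v.2 hw⟩, hw, rfl⟩

/-- Euler's formula for a finite tree, in terms of degrees. -/
theorem IsTree.sum_two_sub_degree [Fintype V] (hG : G.IsTree) :
    ∑ v, (2 - ((G.neighborSet v).ncard : ℤ)) = 2 := by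
  classical
  have h1 := hG.card_edgeFinset
  have h2 := G.sum_degrees_eq_twice_card_edges
  have h3 : ∀ v, ((G.neighborSet v).ncard : ℤ) = G.degree v := fun v => by
    rw [← G.card_neighborSet_eq_degree, ← Nat.card_eq_fintype_card, Nat.card_coe_set_eq]
  simp only [h3, Finset.sum_sub_distrib, Finset.sum_const, Finset.card_univ, nsmul_eq_mul,
    ← Nat.cast_sum, h2, ← h1]
  push_cast
  ring

/-- Euler's formula for a finite forest, in terms of degrees. -/
theorem IsAcyclic.sum_two_sub_degree [Fintype V] (hG : G.IsAcyclic) :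
    ∑ v, (2 - ((G.neighborSet v).ncard : ℤ)) = 2 * Nat.card G.ConnectedComponent := by
  classical
  rw [← Finset.sum_fiberwise (s := Finset.univ) (g := G.connectedComponentMk),
    Nat.card_eq_fintype_card]
  have h : ∀ C : G.ConnectedComponent,
      ∑ v with G.connectedComponentMk v = C, (2 - ((G.neighborSet v).ncard : ℤ)) = 2 := by
    intro C
    have := (hG.isTree_connectedComponent C).sum_two_sub_degree
    refine Eq.trans (b := ∑ v : C, (2 - ((G.neighborSet v.1).ncard : ℤ)))
      (Finset.sum_subtype _ (fun v => by rw [Finset.mem_filter]; exact and_iff_right (Finset.mem_univ v)) _)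
      (Eq.trans ?_ this)
    refine Finset.sum_congr (by congr!) fun v _ => ?_
    rw [ConnectedComponent.ncard_neighborSet_toSimpleGraph C v]
  simp only [h, Finset.sum_const, Finset.card_univ, nsmul_eq_mul]
  ring

theorem Subgraph.ncard_neighborSet_coe (H : G.Subgraph) (v : H.verts) :
    (H.coe.neighborSet v).ncard = (H.neighborSet v).ncard := by
  rw [← Set.ncard_image_of_injective _ Subtype.val_injective]
  congr 1
  ext w
  constructor
  · rintro ⟨w, hw, rfl⟩
    exact hw
  · intro hw
    exact ⟨⟨w, H.edge_vert hw.symm⟩, hw, rfl⟩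

end SimpleGraph

namespace AcyclicMatrix

open SimpleGraph

variable {V : Type*} [Fintype V] {G : SimpleGraph V}

open Classical in
theorem sum_two_sub_deg (hG : G.IsAcyclic) (H : G.Subgraph) :
    ∑ v with v ∈ H.verts, (2 - (deg H v : ℤ)) = 2 * numComponents H := by
  rw [numComponents, ← (hG.subgraph H).sum_two_sub_degree]
  refine Eq.trans (b := ∑ v : H.verts, (2 - (deg H v.1 : ℤ)))
    (Finset.sum_subtype _ (fun v => by simp) _) ?_
  exact Finset.sum_congr rfl fun v _ => by rw [H.ncard_neighborSet_coe, deg]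

/-- Deleting an independent set of vertices from a forest. -/
theorem numComponents_deleteVerts (hG : G.IsAcyclic) (H : G.Subgraph) {T : Finset V}
    (hT : (T : Set V) ⊆ H.verts) (hind : ∀ u ∈ T, ∀ v ∈ T, ¬ H.Adj u v) :
    (numComponents H : ℤ) = numComponents (H.deleteVerts T) + ∑ u ∈ T, (1 - (deg H u : ℤ)) := by
  classical
  have h1 := sum_two_sub_deg hG H
  have h2 := sum_two_sub_deg hG (H.deleteVerts T)
  set S : Finset V := Finset.univ.filter (· ∈ (H.deleteVerts (T : Set V)).verts)
  have hS : ∀ v, v ∈ S ↔ v ∈ H.verts ∧ v ∉ T := fun v => by simp [S]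
  have hdisj : Disjoint S T := Finset.disjoint_left.2 fun v hv hv' => ((hS v).1 hv).2 hv'
  have hunion : Finset.univ.filter (· ∈ H.verts) = S ∪ T := by
    ext v
    have : v ∈ T → v ∈ H.verts := fun h => hT h
    simp only [Finset.mem_filter, Finset.mem_univ, true_and, Finset.mem_union, hS]
    tauto
  have hdegT : ∀ u ∈ T, deg H u = (S.filter (H.Adj · u)).card := fun u hu => by
    rw [deg, ← Set.ncard_coe_finset]
    congr 1
    ext v
    simp only [Subgraph.mem_neighborSet, Finset.coe_filter, Set.mem_ofPred_eq, hS]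
    exact ⟨fun h => ⟨⟨H.edge_vert h.symm, fun hv => hind u hu v hv h⟩, h.symm⟩, fun h => h.2.symm⟩
  have hdegS : ∀ v ∈ S, deg H v = deg (H.deleteVerts T) v + (T.filter (H.Adj v ·)).card := by
    intro v hv
    obtain ⟨hv1, hv2⟩ := (hS v).1 hv
    rw [deg, deg, ← Set.ncard_coe_finset (T.filter (H.Adj v ·)),
      ← Set.ncard_union_eq _ (Set.toFinite _) (Set.toFinite _)]
    · congr 1
      ext u
      have : H.Adj v u → u ∈ H.verts := fun h => H.edge_vert h.symm
      simp only [Subgraph.mem_neighborSet, Set.mem_union, Subgraph.deleteVerts_adj,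
        Finset.coe_filter, Set.mem_ofPred_eq, Finset.mem_coe]
      tauto
    · refine Set.disjoint_left.2 fun u hu hu' => ?_
      simp only [Subgraph.mem_neighborSet, Subgraph.deleteVerts_adj,
        Finset.coe_filter, Set.mem_ofPred_eq, Finset.mem_coe] at hu hu'
      tauto
  -- Double counting of the edges between `S` and `T`; by independence these are all the edges at
  -- `T`.
  have hcount : ∑ v ∈ S, (T.filter (H.Adj v ·)).card = ∑ u ∈ T, deg H u := by
    rw [Finset.sum_congr rfl hdegT]
    exact Finset.sum_card_bipartiteAbove_eq_sum_card_bipartiteBelow _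
  have h3 : ∑ v ∈ S, (2 - (deg H v : ℤ)) =
      ∑ v ∈ S, (2 - (deg (H.deleteVerts T) v : ℤ)) - ∑ u ∈ T, (deg H u : ℤ) := by
    rw [← Nat.cast_sum, ← hcount, Nat.cast_sum, ← Finset.sum_sub_distrib]
    refine Finset.sum_congr rfl fun v hv => ?_
    rw [hdegS v hv]
    push_cast
    ring
  rw [hunion, Finset.sum_union hdisj, h3, h2] at h1
  simp only [Finset.sum_sub_distrib, Finset.sum_const, nsmul_eq_mul] at h1 ⊢
  linarith

/-! ### The two multiplicity formulas -/

variable {θ : ℝ} {A : Matrix V V ℝ}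

theorem reduced_deleteVerts_verts :
    ((reduced θ A).deleteVerts (boundaryNodal θ A)).verts = (nodal θ A)ᶜ := by
  ext v
  simp only [reduced, boundaryNodal, Subgraph.deleteVerts_verts, Set.mem_sdiff, Set.mem_compl_iff]
  have : v ∈ interiorNodal θ A → v ∈ nodal θ A := fun h => h.1
  tauto

theorem numComponents_reduced_deleteVerts :
    numComponents ((reduced θ A).deleteVerts (boundaryNodal θ A)) =
      Nat.card ((graph A).induce (nodal θ A)ᶜ).ConnectedComponent := by
  refine Nat.card_congr (Iso.connectedComponentEquiv
    { toEquiv := Equiv.setCongr reduced_deleteVerts_verts, map_rel_iff' := ?_ })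
  rintro ⟨v, hv⟩ ⟨w, hw⟩
  have hv' : v ∉ nodal θ A := by rwa [reduced_deleteVerts_verts] at hv
  have hw' : w ∉ nodal θ A := by rwa [reduced_deleteVerts_verts] at hw
  exact ⟨fun h => Subgraph.deleteVerts_adj.2 ⟨hv.1, hv.2, hw.1, hw.2, h, fun h' => hv' h'.1⟩,
    fun h => (Subgraph.deleteVerts_adj.1 h).2.2.2.2.1⟩

theorem mult_eq_numComponents_sub [DecidableEq V] (hA : A.IsSymm) (hG : (graph A).IsAcyclic) :
    (mult θ A : ℤ) = (numComponents ((reduced θ A).deleteVerts (boundaryNodal θ A)) : ℤ) -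
      ((boundaryNodal θ A).ncard : ℤ) := by
  rw [numComponents_reduced_deleteVerts, ← mult_add_ncard_boundaryNodal hA hG]
  push_cast
  ring

theorem mult_eq_numComponents_add [DecidableEq V] (hA : A.IsSymm) (hG : (graph A).IsAcyclic) :
    (mult θ A : ℤ) = (numComponents (reduced θ A) : ℤ) +
      ∑ u ∈ (Set.toFinite (boundaryNodal θ A)).toFinset, ((deg (reduced θ A) u : ℤ) - 2) := by
  have h := numComponents_deleteVerts hG (reduced θ A)
    (T := (Set.toFinite (boundaryNodal θ A)).toFinset)
    (fun v hv => (by simpa using hv : v ∈ boundaryNodal θ A).2)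
    -- The boundary is independent in `F` because edges with two nodal ends were removed.
    (fun u hu v hv huv => huv.2 ⟨((Set.Finite.mem_toFinset _).1 hu).1,
      ((Set.Finite.mem_toFinset _).1 hv).1⟩)
  rw [Set.Finite.coe_toFinset] at h
  rw [h, mult_eq_numComponents_sub hA hG, Set.ncard_eq_toFinset_card _ (Set.toFinite _)]
  simp only [Finset.sum_sub_distrib, Finset.sum_const, nsmul_eq_mul]
  ring

end AcyclicMatrix

/-! ### Connectivity and subgraphs of forests -/

namespace SimpleGraph

variable {V W : Type*} {G H : SimpleGraph V}

/-- In a forest there is at most one edge between two different components of a subgraph. -/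
theorem IsAcyclic.adj_unique (hG : G.IsAcyclic) (hle : H ≤ G) {v v' w w' : V}
    (hv : H.Reachable v v') (hw : H.Reachable w w') (hvw : ¬ H.Reachable v w)
    (h : G.Adj v w) (h' : G.Adj v' w') : v = v' ∧ w = w' := by
  by_contra hne
  refine isBridge_iff.1 (isAcyclic_iff_forall_adj_isBridge.1 hG h) ?_
  -- `H` avoids the edge `vw`, so a second edge between the two components would give a detour
  -- around a bridge.
  have hle' : H ≤ G.deleteEdges {s(v, w)} := by
    intro a b hab
    refine deleteEdges_adj.2 ⟨hle hab, fun he => hvw ?_⟩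
    rcases Sym2.eq_iff.1 (Set.mem_singleton_iff.1 he) with ⟨rfl, rfl⟩ | ⟨rfl, rfl⟩
    · exact hab.reachable
    · exact hab.symm.reachable
  have hadj : (G.deleteEdges {s(v, w)}).Adj v' w' := by
    refine deleteEdges_adj.2 ⟨h', fun he => ?_⟩
    rcases Sym2.eq_iff.1 (Set.mem_singleton_iff.1 he) with ⟨rfl, rfl⟩ | ⟨rfl, rfl⟩
    · exact hne ⟨rfl, rfl⟩
    · exact hvw hv
  exact ((hv.mono hle').trans hadj.reachable).trans (hw.symm.mono hle')

/-- The range of `φ` is closed under `H`-adjacency, so a walk starting there stays there and lifts.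
-/
theorem Reachable.exists_comap {φ : W → V}
    (hφ : ∀ a v, H.Adj (φ a) v → v ∈ Set.range φ) {a : W} {v : V} (h : H.Reachable (φ a) v) :
    ∃ b, φ b = v ∧ (H.comap φ).Reachable a b := by
  obtain ⟨p⟩ := h
  generalize hu : φ a = u at p
  induction p generalizing a with
  | nil => exact ⟨a, hu, Reachable.refl _⟩
  | cons hadj p ih =>
    subst hu
    obtain ⟨c, rfl⟩ := hφ a _ hadj
    obtain ⟨b, hb, hr⟩ := ih rfl
    exact ⟨b, hb, (show (H.comap φ).Adj a c from hadj).reachable.trans hr⟩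

theorem connected_comap [Nonempty W] {φ : W → V} (hinj : Function.Injective φ)
    (hφ : ∀ a v, H.Adj (φ a) v → v ∈ Set.range φ) (hr : ∀ a b, H.Reachable (φ a) (φ b)) :
    (H.comap φ).Connected := by
  refine ⟨fun a b => ?_⟩
  obtain ⟨c, hc, h⟩ := (hr a b).exists_comap hφ
  rwa [← hinj hc]

theorem Reachable.iff_of_adj {p : V → Prop} (hp : ∀ v w, H.Adj v w → (p v ↔ p w)) {v w : V}
    (h : H.Reachable v w) : p v ↔ p w := by
  obtain ⟨q⟩ := h
  induction q with
  | nil => rfl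
  | cons h q ih => exact (hp _ _ h).trans ih

end SimpleGraph

/-! ### The pieces of the construction -/

namespace AcyclicMatrix

open Matrix

variable {V W : Type*} {θ : ℝ} {A : Matrix V V ℝ}

theorem graph_submatrix (hA : A.IsSymm) {φ : W → V} (hφ : Function.Injective φ) :
    graph (A.submatrix φ φ) = (graph A).comap φ := by
  ext a b
  rw [graph_adj (hA.submatrix φ), SimpleGraph.comap_adj, graph_adj hA, hφ.ne_iff,
    submatrix_apply]

/-- The principal submatrix of an acyclic matrix on a vertex set that is connected by means of
the edges of a subgraph. -/
theorem isTree_graph_submatrix [Nonempty W] (hA : A.IsSymm) (hG : (graph A).IsAcyclic)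
    {H : SimpleGraph V} (hH : H ≤ graph A) {φ : W → V} (hinj : Function.Injective φ)
    (hφ : ∀ a v, H.Adj (φ a) v → v ∈ Set.range φ) (hr : ∀ a b, H.Reachable (φ a) (φ b)) :
    (graph (A.submatrix φ φ)).IsTree := by
  rw [graph_submatrix hA hinj]
  exact ⟨(SimpleGraph.connected_comap hinj hφ hr).mono fun a b h => hH h,
    hG.of_comap ⟨φ, hinj⟩⟩

theorem exists_adj_of_joined {p : ℕ} {n : Fin p → ℕ} {φ : (Σ j, Fin (n j)) → V} (hA : A.IsSymm)
    (hinj : Function.Injective φ) {j k : Fin p}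
    (hjk : j ≠ k)
    (h : Joined (fun j => A.submatrix (fun r : Fin (n j) => φ ⟨j, r⟩) fun r => φ ⟨j, r⟩)
      (A.submatrix φ φ) j k) :
    ∃ r s, (graph A).Adj (φ ⟨j, r⟩) (φ ⟨k, s⟩) := by
  obtain ⟨r, s, ω, hω, h⟩ := h
  refine ⟨r, s, (graph_adj hA).2 ⟨fun h => hjk (congrArg Sigma.fst (hinj h)), ?_⟩⟩
  have h' := congrFun (congrFun h (Sum.inl r)) (Sum.inr s)
  simp only [connection, fromBlocks_apply₁₂, single_apply_same, twoBlocks, submatrix_apply,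
    Sum.elim_inl, Sum.elim_inr] at h'
  rwa [h']

variable [Fintype V]

/-- The graph whose components are the pieces of the construction: the edges of `G_A` that join
two non-nodal vertices or two interior nodal vertices. -/
def pieceGraph (θ : ℝ) (A : Matrix V V ℝ) : SimpleGraph V where
  Adj v w := (graph A).Adj v w ∧
    ((v ∉ nodal θ A ∧ w ∉ nodal θ A) ∨ (v ∈ interiorNodal θ A ∧ w ∈ interiorNodal θ A))
  symm := ⟨fun _ _ h => ⟨h.1.symm, h.2.imp And.symm And.symm⟩⟩
  loopless := ⟨fun _ h => h.1.ne rfl⟩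

theorem pieceGraph_le : pieceGraph θ A ≤ graph A := fun _ _ h => h.1

theorem mem_nodal_iff_of_reachable {v w : V} (h : (pieceGraph θ A).Reachable v w) :
    v ∈ nodal θ A ↔ w ∈ nodal θ A := by
  refine h.iff_of_adj fun a b hab => ?_
  rcases hab.2 with h | h
  · exact iff_of_false h.1 h.2
  · exact iff_of_true h.1.1 h.2.1

theorem mem_interiorNodal_iff_of_reachable {v w : V} (h : (pieceGraph θ A).Reachable v w) :
    v ∈ interiorNodal θ A ↔ w ∈ interiorNodal θ A := by
  refine h.iff_of_adj fun a b hab => ?_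
  rcases hab.2 with h | h
  · exact iff_of_false (fun h' => h.1 h'.1) (fun h' => h.2 h'.1)
  · exact iff_of_true h.1 h.2

theorem eq_of_reachable_of_mem_boundaryNodal {v w : V} (hv : v ∈ boundaryNodal θ A)
    (h : (pieceGraph θ A).Reachable v w) : v = w := by
  obtain ⟨p⟩ := h
  cases p with
  | nil => rfl
  | cons h p =>
    rcases h.2 with h | h
    · exact absurd hv.1 h.1
    · exact absurd h.1 hv.2

theorem pieceGraph_adj_of_notMem_boundaryNodal {v w : V} (h : (graph A).Adj v w)
    (hv : v ∉ boundaryNodal θ A) (hw : w ∉ boundaryNodal θ A) : (pieceGraph θ A).Adj v w := by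
  refine ⟨h, ?_⟩
  by_cases hvN : v ∈ nodal θ A
  · have hvI : v ∈ interiorNodal θ A := by_contra fun h => hv ⟨hvN, h⟩
    exact Or.inr ⟨hvI, by_contra fun h' => hw ⟨hvI.2 h, h'⟩⟩
  · refine Or.inl ⟨hvN, fun hwN => hvN ?_⟩
    have hwI : w ∈ interiorNodal θ A := by_contra fun h => hw ⟨hwN, h⟩
    exact hwI.2 h.symm

variable [Fintype W]

/-- The restriction of a generic eigenvector works: every vertex outside the piece is either nodal
or not adjacent to it. -/
theorem isMin_submatrix [Nonempty W] (hA : A.IsSymm) (hG : (graph A).IsAcyclic)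
    {φ : W → V} (hinj : Function.Injective φ)
    (hφ : ∀ a v, (pieceGraph θ A).Adj (φ a) v → v ∈ Set.range φ)
    (hr : ∀ a b, (pieceGraph θ A).Reachable (φ a) (φ b)) (hN : ∀ a, φ a ∉ nodal θ A) :
    IsMin θ (A.submatrix φ φ) := by
  refine ⟨hA.submatrix φ, isTree_graph_submatrix hA hG pieceGraph_le hinj hφ hr, ?_⟩
  obtain ⟨x, hx, hx0⟩ := exists_generic θ A
  have hne : ∀ a, x (φ a) ≠ 0 := fun a h => hN a ((hx0 _).1 h)
  refine ⟨x ∘ φ, ⟨fun h => hne (Classical.arbitrary W) (congrFun h _), funext fun a => ?_⟩, hne⟩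
  have h := congrFun hx (φ a)
  rw [mulVec_apply_eq_sum] at h
  rw [mulVec_apply_eq_sum]
  refine Eq.trans (Fintype.sum_of_injective φ hinj _ _ (fun v hv => ?_) fun b => rfl) h
  by_cases hvN : v ∈ nodal θ A
  · rw [(hx0 v).2 hvN, mul_zero]
  · rw [eq_zero_of_not_adj hA (fun h => hv ⟨a, h⟩)
      (fun h => hv (hφ a v ⟨h, Or.inl ⟨hN a, hvN⟩⟩)), zero_mul]

theorem isZ_submatrix [Nonempty W] [DecidableEq W] (hA : A.IsSymm) (hG : (graph A).IsAcyclic)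
    {φ : W → V} (hinj : Function.Injective φ)
    (hφ : ∀ a v, (pieceGraph θ A).Adj (φ a) v → v ∈ Set.range φ)
    (hr : ∀ a b, (pieceGraph θ A).Reachable (φ a) (φ b)) (hI : ∀ a, φ a ∈ interiorNodal θ A) :
    IsZ θ (A.submatrix φ φ) := by
  classical
  refine ⟨hA.submatrix φ, isTree_graph_submatrix hA hG pieceGraph_le hinj hφ hr, ?_⟩
  rw [mult, Submodule.finrank_eq_zero, Submodule.eq_bot_iff]
  intro y hy
  rw [Module.End.mem_eigenspace_iff, toLin'_apply] at hy
  set Y : V → ℝ := Function.extend φ y 0 with hY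
  have hYφ : ∀ a, Y (φ a) = y a := fun a => hinj.extend_apply _ _ _
  have hY0 : ∀ v ∉ Set.range φ, Y v = 0 := fun v hv => Function.extend_apply' _ _ _ hv
  -- Extended by zero, `y` fails the eigenvector equation only at boundary vertices, since any other
  -- neighbour of the piece lies in it.
  have hg : ∀ u ∉ boundaryNodal θ A, (A *ᵥ Y - θ • Y) u = 0 := by
    intro u hu
    rw [Pi.sub_apply, Pi.smul_apply, smul_eq_mul, sub_eq_zero, mulVec_apply_eq_sum]
    by_cases hur : u ∈ Set.range φ
    · obtain ⟨a, rfl⟩ := hur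
      have h := congrFun hy a
      rw [mulVec_apply_eq_sum, Pi.smul_apply, smul_eq_mul] at h
      rw [hYφ, ← h]
      refine (Fintype.sum_of_injective φ hinj _ _ (fun v hv => ?_) fun b => ?_).symm
      · rw [hY0 v hv, mul_zero]
      · rw [hYφ, submatrix_apply]
    · rw [hY0 u hur, mul_zero]
      refine Finset.sum_eq_zero fun v _ => ?_
      by_cases hvr : v ∈ Set.range φ
      · obtain ⟨a, rfl⟩ := hvr
        rw [eq_zero_of_not_adj hA (fun h => hur ⟨a, h.symm⟩) (fun h => hur (hφ a u
          (pieceGraph_adj_of_notMem_boundaryNodal h.symm (fun h' => h'.2 (hI a)) hu))), zero_mul]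
      · rw [hY0 v hvr, mul_zero]
  -- The error is repaired by a `z` vanishing on the nodal set. So `Y - z` solves the eigenvector
  -- equation and agrees with `y` on the piece, where it must vanish.
  obtain ⟨z, hz0, hz⟩ := exists_mulVec_sub_smul_eq hA hG hg
  ext a
  have h := mem_nodal_iff.1 (hI a).1 (Y - z) (by
    rw [mulVec_sub, smul_sub, sub_eq_sub_iff_sub_eq_sub, hz])
  rw [Pi.sub_apply, hYφ, hz0 _ (hI a).1, sub_zero] at h
  exact h

/-- With a single non-nodal neighbour `v`, the equation of a generic eigenvector at `u` would reduce
to `A u v * x v = 0`. -/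
theorem exists_two_adj_of_mem_boundaryNodal (hA : A.IsSymm) {u : V}
    (hu : u ∈ boundaryNodal θ A) :
    ∃ v ∉ nodal θ A, ∃ w ∉ nodal θ A, v ≠ w ∧ (graph A).Adj u v ∧ (graph A).Adj u w := by
  obtain ⟨x, hx, hx0⟩ := exists_generic θ A
  obtain ⟨huN, v, hv, huv⟩ := mem_boundaryNodal_iff.1 hu
  by_contra! hcon
  have h := congrFun hx u
  rw [mulVec_apply_eq_sum, Pi.smul_apply, (hx0 u).2 huN, smul_zero,
    Finset.sum_eq_single v (fun w _ hwv => ?_) (fun h => absurd (Finset.mem_univ v) h)] at h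
  · rcases mul_eq_zero.1 h with h | h
    · exact ((graph_adj hA).1 huv).2 h
    · exact hv ((hx0 v).1 h)
  · by_cases hw : w ∈ nodal θ A
    · rw [(hx0 w).2 hw, mul_zero]
    · rw [eq_zero_of_not_adj hA (ne_of_mem_of_not_mem huN hw) (hcon v hv w hw hwv.symm huv),
        zero_mul]

/-! ### Assembling the pieces -/

section Construction

variable {p : ℕ} {n : Fin p → ℕ} {φ : (Σ j, Fin (n j)) → V}

theorem joined_of_adj (hA : A.IsSymm) (hG : (graph A).IsAcyclic)
    (hinj : Function.Injective φ)
    (hpiece : ∀ a b, (pieceGraph θ A).Reachable (φ a) (φ b) ↔ a.1 = b.1) {j k : Fin p} (hjk : j ≠ k)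
    {r : Fin (n j)} {s : Fin (n k)} (h : (graph A).Adj (φ ⟨j, r⟩) (φ ⟨k, s⟩)) :
    Joined (fun j => A.submatrix (fun r : Fin (n j) => φ ⟨j, r⟩) fun r => φ ⟨j, r⟩)
      (A.submatrix φ φ) j k := by
  refine ⟨r, s, A (φ ⟨j, r⟩) (φ ⟨k, s⟩), ((graph_adj hA).1 h).2, ?_⟩
  have hzero : ∀ a b, ¬ (r = a ∧ s = b) → A (φ ⟨j, a⟩) (φ ⟨k, b⟩) = 0 := fun a b hab => by
    refine eq_zero_of_not_adj hA (fun h => hjk (congrArg Sigma.fst (hinj h)))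
      fun h' => hab ?_
    obtain ⟨h1, h2⟩ := hG.adj_unique pieceGraph_le ((hpiece ⟨j, r⟩ ⟨j, a⟩).2 rfl)
      ((hpiece ⟨k, s⟩ ⟨k, b⟩).2 rfl) (fun h => hjk ((hpiece _ _).1 h)) h h'
    exact ⟨eq_of_heq (Sigma.mk.inj (hinj h1)).2, eq_of_heq (Sigma.mk.inj (hinj h2)).2⟩
  ext a b
  rcases a with a | a <;> rcases b with b | b
  · rfl
  · simp only [connection, fromBlocks_apply₁₂, twoBlocks, submatrix_apply, Sum.elim_inl,
      Sum.elim_inr, single_apply]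
    split_ifs with hab
    · rw [hab.1, hab.2]
    · exact hzero a b hab
  · simp only [connection, fromBlocks_apply₂₁, twoBlocks, submatrix_apply, Sum.elim_inl,
      Sum.elim_inr, single_apply]
    rw [hA.apply]
    split_ifs with hab
    · rw [hab.1, hab.2]
    · exact hzero b a fun h => hab h.symm
  · rfl

/-- If `φ` enumerates a component of `G_A`, divided into the components of the piece graph, then
the corresponding principal submatrix is obtained by the construction. -/
theorem isConstruction_submatrix (hA : A.IsSymm) (hG : (graph A).IsAcyclic)
    (hinj : Function.Injective φ)
    (hpiece : ∀ a b, (pieceGraph θ A).Reachable (φ a) (φ b) ↔ a.1 = b.1)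
    (hclosed : ∀ a v, (graph A).Adj (φ a) v → v ∈ Set.range φ)
    (hreach : ∀ a b, (graph A).Reachable (φ a) (φ b)) (hne : ∀ j, Nonempty (Fin (n j)))
    (hne' : Nonempty (Fin p)) :
    IsConstruction θ {j | ∃ r, φ ⟨j, r⟩ ∈ boundaryNodal θ A}
      (fun j => A.submatrix (fun r : Fin (n j) => φ ⟨j, r⟩) fun r => φ ⟨j, r⟩) (A.submatrix φ φ) := by
  have hinj' : ∀ j, Function.Injective fun r : Fin (n j) => φ ⟨j, r⟩ := fun j =>
    hinj.comp sigma_mk_injective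
  have hreach' : ∀ j r s, (pieceGraph θ A).Reachable (φ ⟨j, r⟩) (φ ⟨j, s⟩) := fun j r s =>
    (hpiece _ _).2 rfl
  have hclosed' : ∀ j r v, (pieceGraph θ A).Adj (φ ⟨j, r⟩) v →
      v ∈ Set.range fun r : Fin (n j) => φ ⟨j, r⟩ := by
    intro j r v h
    obtain ⟨⟨k, s⟩, rfl⟩ := hclosed ⟨j, r⟩ v (pieceGraph_le h)
    obtain rfl : j = k := (hpiece ⟨j, r⟩ ⟨k, s⟩).1 h.reachable
    exact ⟨s, rfl⟩
  have hmin : ∀ j r, φ ⟨j, r⟩ ∉ nodal θ A →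
      IsMin θ (A.submatrix (fun r : Fin (n j) => φ ⟨j, r⟩) fun r => φ ⟨j, r⟩) := by
    intro j r hr
    have := hne j
    exact isMin_submatrix hA hG (hinj' j) (hclosed' j) (hreach' j) fun s h =>
      hr ((mem_nodal_iff_of_reachable (hreach' j r s)).2 h)
  have hL : ∀ j r, φ ⟨j, r⟩ ∉ nodal θ A → ¬ ∃ s, φ ⟨j, s⟩ ∈ boundaryNodal θ A := by
    rintro j r hr ⟨s, hs⟩
    exact hr ((mem_nodal_iff_of_reachable (hreach' j r s)).2 hs.1)
  constructor
  · rintro j ⟨r, hr⟩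
    rw [← Fintype.card_fin (n j), Fintype.card_eq_one_iff]
    exact ⟨r, fun s => (hinj' j (eq_of_reachable_of_mem_boundaryNodal hr (hreach' j r s))).symm⟩
  · intro j hj
    have := hne j
    obtain ⟨r⟩ := hne j
    by_cases hr : φ ⟨j, r⟩ ∈ nodal θ A
    · have hrI : φ ⟨j, r⟩ ∈ interiorNodal θ A := by_contra fun h => hj ⟨r, hr, h⟩
      exact Or.inl (isZ_submatrix hA hG (hinj' j) (hclosed' j) (hreach' j) fun s =>
        (mem_interiorNodal_iff_of_reachable (hreach' j r s)).1 hrI)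
    · exact Or.inr (hmin j r hr)
  · intro j
    rfl
  · intro j k hjk
    by_cases h : ∃ r s, (graph A).Adj (φ ⟨j, r⟩) (φ ⟨k, s⟩)
    · obtain ⟨r, s, h⟩ := h
      exact Or.inl (joined_of_adj hA hG hinj hpiece hjk h)
    · have hzero : ∀ r s, A (φ ⟨j, r⟩) (φ ⟨k, s⟩) = 0 := fun r s =>
        eq_zero_of_not_adj hA (fun h => hjk (congrArg Sigma.fst (hinj h)))
          fun h' => h ⟨r, s, h'⟩
      refine Or.inr ?_
      ext a b
      rcases a with a | a <;> rcases b with b | b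
      · rfl
      · exact hzero a b
      · exact (hA.apply _ _).trans (hzero b a)
      · rfl
  · obtain ⟨j⟩ := hne'
    obtain ⟨r⟩ := hne j
    have : Nonempty (Σ j, Fin (n j)) := ⟨⟨j, r⟩⟩
    exact isTree_graph_submatrix hA hG le_rfl hinj hclosed hreach
  · intro j hj k hk hjk h
    obtain ⟨r, s, hadj⟩ := exists_adj_of_joined hA hinj hjk h
    exact hjk ((hpiece _ _).1 (pieceGraph_adj_of_notMem_boundaryNodal hadj (fun h => hj ⟨r, h⟩)
      fun h => hk ⟨s, h⟩).reachable)
  · rintro j ⟨r, hr⟩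
    obtain ⟨v, hv, w, hw, hvw, hrv, hrw⟩ := exists_two_adj_of_mem_boundaryNodal hA hr
    obtain ⟨⟨k, s⟩, rfl⟩ := hclosed _ _ hrv
    obtain ⟨⟨l, t⟩, rfl⟩ := hclosed _ _ hrw
    have hj : ∀ i q, φ ⟨i, q⟩ ∉ nodal θ A → j ≠ i := by
      rintro _ q hq rfl
      exact hL _ q hq ⟨r, hr⟩
    refine ⟨k, hL k s hv, l, hL l t hw, ?_, hmin k s hv, hmin l t hw,
      joined_of_adj hA hG hinj hpiece (hj k s hv) hrv,
      joined_of_adj hA hG hinj hpiece (hj l t hw) hrw⟩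
    -- Two edges from one vertex into the same piece would close a cycle.
    rintro rfl
    exact hvw (hG.adj_unique pieceGraph_le (SimpleGraph.Reachable.refl _) (hreach' k s t)
      (fun h => hj k s hv ((hpiece _ _).1 h)) hrv hrw).2

end Construction

theorem classA_of_isAcyclic (hA : A.IsSymm) (hG : (graph A).IsAcyclic) : ClassA θ A := by
  classical
  obtain ⟨k, ⟨eC⟩⟩ := Finite.exists_equiv_fin (graph A).ConnectedComponent
  set H := pieceGraph θ A
  -- `f` sends a piece to the component of `G_A` containing it; its fibres index the pieces of each
  -- direct summand.
  let f : H.ConnectedComponent → (graph A).ConnectedComponent :=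
    SimpleGraph.ConnectedComponent.map (SimpleGraph.Hom.ofLE pieceGraph_le)
  have hf : ∀ v, f (H.connectedComponentMk v) = (graph A).connectedComponentMk v := fun _ => rfl
  have h1 : ∀ i : Fin k, ∃ m, Nonempty ({P : H.ConnectedComponent // f P = eC.symm i} ≃ Fin m) :=
    fun i => Finite.exists_equiv_fin _
  choose p eP using h1
  replace eP := fun i => (eP i).some.symm
  have h2 : ∀ i (j : Fin (p i)), ∃ m, Nonempty ((eP i j).1.supp ≃ Fin m) :=
    fun i j => Finite.exists_equiv_fin _
  choose n eS using h2
  replace eS := fun i j => (eS i j).some.symm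
  let φ : ∀ i, (Σ j, Fin (n i j)) → V := fun i a => (eS i a.1 a.2).1
  have hφH : ∀ i a, H.connectedComponentMk (φ i a) = (eP i a.1).1 := fun i a =>
    (eS i a.1 a.2).2
  have hφG : ∀ i a, (graph A).connectedComponentMk (φ i a) = eC.symm i := fun i a => by
    rw [← hf, hφH, (eP i a.1).2]
  have hφsurj : ∀ i v, (graph A).connectedComponentMk v = eC.symm i → v ∈ Set.range (φ i) := by
    intro i v hv
    obtain ⟨j, hj⟩ := (eP i).surjective ⟨H.connectedComponentMk v, (hf v).trans hv⟩
    obtain ⟨r, hr⟩ := (eS i j).surjective ⟨v, by rw [hj]; rfl⟩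
    exact ⟨⟨j, r⟩, congrArg Subtype.val hr⟩
  have hpiece : ∀ i a b, H.Reachable (φ i a) (φ i b) ↔ a.1 = b.1 := by
    intro i a b
    rw [← SimpleGraph.ConnectedComponent.eq, hφH, hφH, Subtype.val_inj, (eP i).injective.eq_iff]
  have hinj : ∀ i, Function.Injective (φ i) := by
    rintro i ⟨j, r⟩ ⟨j', r'⟩ h
    obtain rfl : j = j' := (hpiece i ⟨j, r⟩ ⟨j', r'⟩).1 (h ▸ SimpleGraph.Reachable.refl _)
    exact congrArg (Sigma.mk j) ((eS i j).injective (Subtype.ext h))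
  let e : (Σ i, Σ j, Fin (n i j)) ≃ V := Equiv.ofBijective (fun a => φ a.1 a.2) (by
    constructor
    · rintro ⟨i, a⟩ ⟨i', a'⟩ h
      obtain rfl : i = i' := eC.symm.injective (by
        rw [← hφG i a, ← hφG i' a']; exact congrArg _ h)
      exact congrArg (Sigma.mk i) (hinj i h)
    · intro v
      obtain ⟨a, ha⟩ := hφsurj (eC ((graph A).connectedComponentMk v)) v
        (eC.symm_apply_apply _).symm
      exact ⟨⟨_, a⟩, ha⟩)
  refine ⟨k, p, n, fun i => A.submatrix (φ i) (φ i), e, fun i => ⟨_, _,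
    isConstruction_submatrix hA hG (hinj i) (hpiece i) (fun a v h => hφsurj i v ?_)
      (fun a b => ?_) (fun j => ?_) ?_⟩, ?_⟩
  · rw [← hφG i a]
    exact SimpleGraph.ConnectedComponent.sound h.symm.reachable
  · rw [← SimpleGraph.ConnectedComponent.eq, hφG, hφG]
  · obtain ⟨v, hv⟩ := (eP i j).1.nonempty_supp
    exact ⟨(eS i j).symm ⟨v, hv⟩⟩
  · obtain ⟨v, hv⟩ := (eC.symm i).nonempty_supp
    exact ⟨(eP i).symm ⟨H.connectedComponentMk v, hv⟩⟩
  · ext u v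
    obtain ⟨⟨i, a⟩, rfl⟩ := e.surjective u
    obtain ⟨⟨i', b⟩, rfl⟩ := e.surjective v
    rw [reindex_apply, submatrix_apply, e.symm_apply_apply, e.symm_apply_apply]
    by_cases h : i = i'
    · subst h
      rw [blockDiagonal'_apply_eq]
      rfl
    · rw [blockDiagonal'_apply_ne _ _ _ h]
      have hcomp : (graph A).connectedComponentMk (e ⟨i, a⟩) ≠
          (graph A).connectedComponentMk (e ⟨i', b⟩) := fun h' => h (eC.symm.injective (by
        rw [← hφG i a, ← hφG i' b]; exact h'))
      exact eq_zero_of_not_adj hA (fun h' => hcomp (by rw [h']))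
        fun h' => hcomp (SimpleGraph.ConnectedComponent.sound h'.reachable)

end AcyclicMatrix

theorem mainTheorem1 (θ : ℝ) (n : ℕ) (A : Matrix (Fin n) (Fin n) ℝ) (hsymm : A.IsSymm)
    (hacyclic : (AcyclicMatrix.graph A).IsAcyclic) :
    AcyclicMatrix.ClassA θ A ∧
    (AcyclicMatrix.mult θ A : ℤ) =
      (AcyclicMatrix.numComponents (AcyclicMatrix.reduced θ A) : ℤ) +
        ∑ u ∈ (Set.toFinite (AcyclicMatrix.boundaryNodal θ A)).toFinset,
          ((AcyclicMatrix.deg (AcyclicMatrix.reduced θ A) u : ℤ) - 2) ∧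
    (AcyclicMatrix.mult θ A : ℤ) =
      (AcyclicMatrix.numComponents ((AcyclicMatrix.reduced θ A).deleteVerts
        (AcyclicMatrix.boundaryNodal θ A)) : ℤ) -
        ((AcyclicMatrix.boundaryNodal θ A).ncard : ℤ) :=
  ⟨AcyclicMatrix.classA_of_isAcyclic hsymm hacyclic,
    AcyclicMatrix.mult_eq_numComponents_add hsymm hacyclic,
    AcyclicMatrix.mult_eq_numComponents_sub hsymm hacyclic⟩
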